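/- Let $X$ be a complex manifold and let $p,q\ge 0$ be integers. Let $\Omega^k$ (resp. $\overline{\Omega}^k$) be the sheaf of holomorphic (resp. antiholomorphic) $k$-forms on $X$, with $\Omega^0=\mathcal O$ and $\overline\Omega^0=\overline{\mathcal O}$, and let $\mathbb Z(p)=(2\pi i)^p\mathbb Z\subset\mathbb C$. For a subgroup $A\subset\mathbb C$, let $\mathcal B_A^\bullet$ be the complex of sheaves with the constant sheaf $A$ in degree $0$ and $\Omega^k_{<p}\oplus\overline\Omega^k_{<q}$ in degree $k+1$ for $k\ge0$, where $\Omega^k_{<p}=\Omega^k$ if $k<p$ and $0$ otherwise, and likewise $\overline\Omega^k_{<q}$: $$A\xrightarrow{(+,-)}\mathcal O\oplus\overline{\mathcal O}\xrightarrow{(\partial,\bar\partial)}\Omega^1\oplus\overline\Omega^1\longrightarrow\cdots .$$ Write $H^{p,q}_{BC}(X,\mathbb C)=\mathbb H^{p+q}(X,\mathcal B_{\mathbb C}^\bullet)$ for the Bott–Chern cohomology in its hypercohomological form, and define the integral Bott–Chern cohomology by $H^{p,q}_{BC}(X,\mathbb Z)=\mathbb H^{p+q}(X,\mathcal B_{\mathbb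 Z(p)}^\bullet)$. The inclusion $\mathbb Z(p)\subset\mathbb C$ induces $$\varepsilon_{BC}:H^{p,q}_{BC}(X,\mathbb Z)\to H^{p,q}_{BC}(X,\mathbb C),\qquad \varepsilon:H^{p+q}(X,\mathbb Z(p))\to H^{p+q}(X,\mathbb C),$$ and the projections of the complexes onto their term of degree $0$ induce $$\varphi_{\mathbb Z}:H^{p,q}_{BC}(X,\mathbb Z)\to H^{p+q}(X,\mathbb Z(p)),\qquad \varphi:H^{p,q}_{BC}(X,\mathbb C)\to H^{p+q}(X,\mathbb C).$$ (1) If $\xi\in H^{p,q}_{BC}(X,\mathbb C)$ and $\alpha\in H^{p+q}(X,\mathbb Z(p))$ satisfy $\varphi(\xi)=\varepsilon(\alpha)$, then there is a class $\tilde\xi\in H^{p,q}_{BC}(X,\mathbb Z)$ such that $\varepsilon_{BC}(\tilde\xi)=\xi$ and $\varphi_{\mathbb Z}(\tilde\xi)=\alpha$. (2) Such a class need not be unique: for every $n\ge0$ there are a connected complex manifold $X$ of dimension $n$, integers $p,q\ge0$, and classes $\xi\in H^{p,q}_{BC}(X,\mathbb C)$, $\alpha\in H^{p+q}(X,\mathbb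 Z(p))$ with $\varphi(\xi)=\varepsilon(\alpha)$ for which there are two distinct classes $\tilde\xi$ as in (1). -/

import Mathlib

open scoped Manifold ContDiff

universe u

namespace BottChern

open CategoryTheory TopologicalSpace Opposite
open scoped Topology

noncomputable section

/-- A sheaf of functions with values in `M`: for every open set `U` a group of functions `U → M`,
stable under restriction and characterised by a local condition. -/
structure LocalSections (X : Type u) [TopologicalSpace X] (M : Type) [AddCommGroup M] where
  sec : ∀ U : Opens X, AddSubgroup (U → M)
  res : ∀ {U V : Opens X} (h : V ≤ U) (f : U → M), f ∈ sec U →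
    (fun x : V => f ⟨x, h x.2⟩) ∈ sec V
  loc : ∀ (U : Opens X) (f : U → M),
    (∀ x : U, ∃ (V : Opens X) (h : V ≤ U), x.1 ∈ V ∧ (fun y : V => f ⟨y, h y.2⟩) ∈ sec V) →
      f ∈ sec U

namespace LocalSections
variable {X : Type u} [TopologicalSpace X] {M N : Type} [AddCommGroup M] [AddCommGroup N]

/-- The presheaf of abelian groups `U ↦ F.sec U`. -/
def presheaf (F : LocalSections X M) : (Opens (TopCat.of X))ᵒᵖ ⥤ AddCommGrpCat.{u} where
  obj U := AddCommGrpCat.of (F.sec U.unop)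
  map i := AddCommGrpCat.ofHom
    { toFun := fun f => ⟨fun x => f.1 ⟨x, i.unop.le x.2⟩, F.res i.unop.le f.1 f.2⟩
      map_zero' := rfl
      map_add' := fun _ _ => rfl }
  map_id _ := rfl
  map_comp _ _ := rfl

/-- Membership in `F.sec U` as a local predicate. -/
def localPredicate (F : LocalSections X M) :
    TopCat.LocalPredicate (X := TopCat.of X) (fun _ => M) where
  pred {U} f := f ∈ F.sec U
  res {V U} i f h := F.res i.le f h
  locality {U} f h := F.loc U f fun x => by
    obtain ⟨V, hx, i, hV⟩ := h x
    exact ⟨V, i.le, hx, hV⟩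

/-- The sheaf of abelian groups `U ↦ F.sec U`. -/
def sheaf (F : LocalSections X M) :
    Sheaf (Opens.grothendieckTopology (TopCat.of X)) AddCommGrpCat.{u} where
  obj := F.presheaf
  property := by
    rw [CategoryTheory.Presheaf.isSheaf_iff_isSheaf_forget _ _ (CategoryTheory.forget AddCommGrpCat)]
    exact (TopCat.subsheafToTypes F.localPredicate).property

/-- The morphism of sheaves given by additive maps on sections commuting with restrictions. -/
def homMk {F : LocalSections X M} {G : LocalSections X N}
    (φ : ∀ U : Opens X, F.sec U →+ G.sec U)
    (h : ∀ (U V : Opens X) (i : V ≤ U) (f : F.sec U) (x : V),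
      (φ V ⟨fun x => f.1 ⟨x, i x.2⟩, F.res i f.1 f.2⟩).1 x = (φ U f).1 ⟨x, i x.2⟩) :
    F.sheaf ⟶ G.sheaf where
  hom.app U := AddCommGrpCat.ofHom (φ U.unop)
  hom.naturality U V i := by
    ext f
    exact Subtype.ext (funext fun x => h _ _ i.unop.le f x)

theorem homMk_comp_homMk {L : Type} [AddCommGroup L] {F : LocalSections X M} {G : LocalSections X N}
    {H : LocalSections X L}
    (φ : ∀ U : Opens X, F.sec U →+ G.sec U) (h) (ψ : ∀ U : Opens X, G.sec U →+ H.sec U) (h')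
    (h0 : ∀ U f, ψ U (φ U f) = 0) : homMk φ h ≫ homMk ψ h' = 0 := by
  ext U f
  exact h0 U.unop f

/-- The direct sum of two sheaves of functions. -/
def prod (F : LocalSections X M) (G : LocalSections X N) : LocalSections X (M × N) where
  sec U :=
    { carrier := {w | (fun x => (w x).1) ∈ F.sec U ∧ (fun x => (w x).2) ∈ G.sec U}
      zero_mem' := ⟨(F.sec U).zero_mem, (G.sec U).zero_mem⟩
      add_mem' := fun h h' => ⟨(F.sec U).add_mem h.1 h'.1, (G.sec U).add_mem h.2 h'.2⟩
      neg_mem' := fun h => ⟨(F.sec U).neg_mem h.1, (G.sec U).neg_mem h.2⟩ }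
  res i w h := ⟨F.res i _ h.1, G.res i _ h.2⟩
  loc U w h := ⟨F.loc U _ fun x => by obtain ⟨V, i, hV, h1, -⟩ := h x; exact ⟨V, i, hV, h1⟩,
    G.loc U _ fun x => by obtain ⟨V, i, hV, -, h2⟩ := h x; exact ⟨V, i, hV, h2⟩⟩

/-- The pair of a section of `F` and a section of `G`. -/
def prodMk {F : LocalSections X M} {G : LocalSections X N} {U : Opens X} :
    F.sec U × G.sec U →+ (F.prod G).sec U where
  toFun w := ⟨fun x => (w.1.1 x, w.2.1 x), w.1.2, w.2.2⟩
  map_zero' := rfl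
  map_add' _ _ := rfl

/-- The first component of a section of `F.prod G`. -/
def prodFst {F : LocalSections X M} {G : LocalSections X N} {U : Opens X} :
    (F.prod G).sec U →+ F.sec U where
  toFun w := ⟨fun x => (w.1 x).1, w.2.1⟩
  map_zero' := rfl
  map_add' _ _ := rfl

/-- The second component of a section of `F.prod G`. -/
def prodSnd {F : LocalSections X M} {G : LocalSections X N} {U : Opens X} :
    (F.prod G).sec U →+ G.sec U where
  toFun w := ⟨fun x => (w.1 x).2, w.2.2⟩
  map_zero' := rfl
  map_add' _ _ := rfl

/-- The constant sheaf with stalk `A`: locally constant functions with values in `A`. -/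
def const (X : Type u) [TopologicalSpace X] (A : AddSubgroup M) : LocalSections X M where
  sec U :=
    { carrier := {f | IsLocallyConstant f ∧ ∀ x, f x ∈ A}
      zero_mem' := ⟨IsLocallyConstant.const 0, fun _ => A.zero_mem⟩
      add_mem' := fun h h' => ⟨h.1.add h'.1, fun x => A.add_mem (h.2 x) (h'.2 x)⟩
      neg_mem' := fun h => ⟨h.1.neg, fun x => A.neg_mem (h.2 x)⟩ }
  res i f h := ⟨h.1.comp_continuous (continuous_inclusion i), fun x => h.2 ⟨x, i x.2⟩⟩
  loc U f h := by
    refine ⟨(IsLocallyConstant.iff_eventually_eq f).2 fun x => ?_, fun x => ?_⟩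
    · obtain ⟨V, i, hV, h1, -⟩ := h x
      have h2 := (IsLocallyConstant.iff_eventually_eq _).1 h1 ⟨x, hV⟩
      have ho : Topology.IsOpenEmbedding (Set.inclusion (show (V : Set X) ⊆ U from i)) :=
        Topology.IsOpenEmbedding.inclusion i (V.2.preimage continuous_subtype_val)
      have hm := ho.map_nhds_eq ⟨x.1, hV⟩
      change Filter.map _ _ = nhds x at hm
      rw [← hm]
      exact Filter.eventually_map.2 h2
    · obtain ⟨V, i, hV, -, h2⟩ := h x
      exact h2 ⟨x, hV⟩

/-- The inclusion of constant sheaves induced by `A ≤ B`. -/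
def constIncl (X : Type u) [TopologicalSpace X] {A B : AddSubgroup M} (h : A ≤ B) :
    (const X A).sheaf ⟶ (const X B).sheaf :=
  homMk (fun _ => AddSubgroup.inclusion fun _ hf => ⟨hf.1, fun x => h (hf.2 x)⟩)
    fun _ _ _ _ _ => rfl

end LocalSections

section Forms

/-- Complex-valued alternating `ℝ`-multilinear forms of degree `k` on the complex vector space `E`. -/
abbrev AltForm (E : Type) [NormedAddCommGroup E] [NormedSpace ℂ E] (k : ℕ) : Type :=
  E [⋀^Fin k]→L[ℝ] ℂ

variable {E : Type} [NormedAddCommGroup E] [NormedSpace ℂ E] {k : ℕ}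

/-- Complex conjugation of forms. -/
def conjForm (η : AltForm E k) : AltForm E k :=
  (Complex.conjCLE : ℂ →L[ℝ] ℂ).compContinuousAlternatingMap η

/-- `g`, the expression of a form of degree `k` in a chart, is a holomorphic form near `y`: its values
are `ℂ`-multilinear (that is, of type `(k,0)`) and depend on the point in a complex analytic way. -/
def HolAt (g : E → AltForm E k) (y : E) : Prop :=
  ∃ f : E → E [⋀^Fin k]→L[ℂ] ℂ, AnalyticAt ℂ f y ∧
    ∀ᶠ z in 𝓝 y, g z = (f z).restrictScalars ℝ

/-- `g` is an antiholomorphic form near `y`: its complex conjugate is a holomorphic form. -/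
def AntiHolAt (g : E → AltForm E k) (y : E) : Prop :=
  HolAt (fun z => conjForm (g z)) y

theorem conjForm_conjForm (η : AltForm E k) : conjForm (conjForm η) = η := by
  ext v; simp [conjForm]

theorem HolAt.contDiffAt {g : E → AltForm E k} {y : E} (h : HolAt g y) : ContDiffAt ℝ 2 g y := by
  obtain ⟨f, hf, hg⟩ := h
  have h1 : ContDiffAt ℝ 2 f y := (hf.contDiffAt (n := 2)).restrict_scalars ℝ
  have h2 := (ContinuousAlternatingMap.restrictScalarsLI (𝕜 := ℂ) (E := E) (F := ℂ)
    (ι := Fin k) ℝ).toContinuousLinearMap.contDiff.contDiffAt.comp (n := 2) y h1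
  exact h2.congr_of_eventuallyEq hg

theorem HolAt.congr {g g' : E → AltForm E k} {y : E} (h : HolAt g y) (e : g' =ᶠ[𝓝 y] g) :
    HolAt g' y := by
  obtain ⟨f, hf, hg⟩ := h
  exact ⟨f, hf, by filter_upwards [hg, e] with z h1 h2 using h2.trans h1⟩

theorem HolAt.add {g g' : E → AltForm E k} {y : E} (h : HolAt g y) (h' : HolAt g' y) :
    HolAt (g + g') y := by
  obtain ⟨f, hf, hg⟩ := h
  obtain ⟨f', hf', hg'⟩ := h'
  exact ⟨f + f', hf.add hf', by
    filter_upwards [hg, hg'] with z h1 h2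
    simp only [Pi.add_apply, h1, h2]; rfl⟩

theorem HolAt.neg {g : E → AltForm E k} {y : E} (h : HolAt g y) : HolAt (-g) y := by
  obtain ⟨f, hf, hg⟩ := h
  exact ⟨-f, hf.neg, by filter_upwards [hg] with z h1; simp only [Pi.neg_apply, h1]; rfl⟩

theorem HolAt.zero (y : E) : HolAt (0 : E → AltForm E k) y :=
  ⟨0, analyticAt_const, Filter.Eventually.of_forall fun _ => rfl⟩

theorem HolAt.extDeriv {g : E → AltForm E k} {y : E} (h : HolAt g y) :
    HolAt (extDeriv g) y := by
  obtain ⟨f, hf, hg⟩ := h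
  refine ⟨_root_.extDeriv f, ?_, ?_⟩
  · exact (ContinuousAlternatingMap.alternatizeUncurryFinCLM ℂ E ℂ).analyticAt _ |>.comp hf.fderiv
  · filter_upwards [eventually_eventually_nhds.2 hg, hf.eventually_analyticAt] with z h1 h2
    have hd : HasFDerivAt f (fderiv ℂ f z) z := h2.differentiableAt.hasFDerivAt
    have e : g =ᶠ[𝓝 z] fun w => (f w).restrictScalars ℝ := h1
    rw [e.extDeriv_eq]
    have h3 := (ContinuousAlternatingMap.restrictScalarsLI (𝕜 := ℂ) (E := E) (F := ℂ)
      (ι := Fin k) ℝ).toContinuousLinearMap.hasFDerivAt.comp z (hd.restrictScalars ℝ)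
    have h4 : fderiv ℝ (fun w => (f w).restrictScalars ℝ) z = _ := h3.fderiv
    ext v
    simp only [_root_.extDeriv, h4, ContinuousAlternatingMap.alternatizeUncurryFin_apply,
      ContinuousAlternatingMap.coe_restrictScalars]
    rfl

theorem extDeriv_conjForm {g : E → AltForm E k} {y : E} (h : DifferentiableAt ℝ g y) :
    extDeriv (fun z => conjForm (g z)) y = conjForm (extDeriv g y) := by
  have h4 : HasFDerivAt (fun z => conjForm (g z)) _ y :=
    (ContinuousLinearMap.compContinuousAlternatingMapCLM (ι := Fin k) ℝ E ℂ ℂ (Complex.conjCLE : ℂ →L[ℝ] ℂ)).hasFDerivAt.comp y h.hasFDerivAt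
  ext v
  rw [_root_.extDeriv, h4.fderiv]
  simp [_root_.extDeriv, ContinuousAlternatingMap.alternatizeUncurryFin_apply, conjForm]

theorem contDiff_conjForm : ContDiff ℝ 2 (conjForm : AltForm E k → AltForm E k) :=
  (ContinuousLinearMap.compContinuousAlternatingMapCLM (ι := Fin k) ℝ E ℂ ℂ
    (Complex.conjCLE : ℂ →L[ℝ] ℂ)).contDiff

theorem conjForm_add (η η' : AltForm E k) : conjForm (η + η') = conjForm η + conjForm η' := by
  ext v; simp [conjForm]

theorem conjForm_neg (η : AltForm E k) : conjForm (-η) = -conjForm η := by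
  ext v; simp [conjForm]

theorem conjForm_zero : conjForm (0 : AltForm E k) = 0 := by
  ext v; simp [conjForm]

theorem AntiHolAt.contDiffAt {g : E → AltForm E k} {y : E} (h : AntiHolAt g y) :
    ContDiffAt ℝ 2 g y := by
  have h1 := contDiff_conjForm.contDiffAt.comp y (HolAt.contDiffAt h)
  simpa only [Function.comp_def, conjForm_conjForm] using h1

/-- The stability properties shared by holomorphic and antiholomorphic forms. -/
structure IsFormClass (P : ∀ {k : ℕ}, (E → AltForm E k) → E → Prop) : Prop where
  contDiffAt : ∀ {k : ℕ} {g : E → AltForm E k} {y : E}, P g y → ContDiffAt ℝ 2 g y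
  congr : ∀ {k : ℕ} {g g' : E → AltForm E k} {y : E}, P g y → g' =ᶠ[𝓝 y] g → P g' y
  add : ∀ {k : ℕ} {g g' : E → AltForm E k} {y : E}, P g y → P g' y → P (g + g') y
  neg : ∀ {k : ℕ} {g : E → AltForm E k} {y : E}, P g y → P (-g) y
  zero : ∀ {k : ℕ} (y : E), P (0 : E → AltForm E k) y
  extDeriv : ∀ {k : ℕ} {g : E → AltForm E k} {y : E}, P g y → P (extDeriv g) y
  eventually : ∀ {k : ℕ} {g : E → AltForm E k} {y : E}, P g y → ∀ᶠ z in 𝓝 y, P g z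

theorem HolAt.eventually {g : E → AltForm E k} {y : E} (h : HolAt g y) :
    ∀ᶠ z in 𝓝 y, HolAt g z := by
  obtain ⟨f, hf, hg⟩ := h
  filter_upwards [eventually_eventually_nhds.2 hg, hf.eventually_analyticAt] with z h1 h2
  exact ⟨f, h2, h1⟩

theorem isFormClass_holAt : IsFormClass (E := E) HolAt where
  contDiffAt h := h.contDiffAt
  congr h e := h.congr e
  add h h' := h.add h'
  neg h := h.neg
  zero y := HolAt.zero y
  extDeriv h := h.extDeriv
  eventually h := h.eventually

theorem isFormClass_antiHolAt : IsFormClass (E := E) AntiHolAt where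
  contDiffAt h := h.contDiffAt
  congr h e := HolAt.congr h (by filter_upwards [e] with z hz; rw [hz])
  add h h' := (HolAt.add h h').congr (Filter.Eventually.of_forall fun z => conjForm_add _ _)
  neg h := (HolAt.neg h).congr (Filter.Eventually.of_forall fun z => conjForm_neg _)
  zero y := (HolAt.zero y).congr (Filter.Eventually.of_forall fun z => conjForm_zero)
  extDeriv h := (HolAt.extDeriv h).congr (by
    filter_upwards [HolAt.eventually h] with z hz
    exact (extDeriv_conjForm ((AntiHolAt.contDiffAt hz).differentiableAt two_ne_zero)).symm)
  eventually h := HolAt.eventually h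

variable {X : Type u} [TopologicalSpace X]

/-- Extension by zero of a field of forms on an open subset. -/
def extendZero {U : Opens X} (θ : U → AltForm E k) : X → AltForm E k :=
  Function.extend Subtype.val θ 0

theorem extendZero_apply {U : Opens X} (θ : U → AltForm E k) {x : X} (hx : x ∈ U) :
    extendZero θ x = θ ⟨x, hx⟩ :=
  Subtype.val_injective.extend_apply θ 0 (⟨x, hx⟩ : U)

variable [ChartedSpace E X]

/-- A field of forms `θ` on `X` assigns to `x : X` an alternating form on `T_x X`, which is
identified with `E` by the differential at `x` of the preferred chart `chartAt E x`.
`chartRep c θ` is the expression of `θ` in the chart `chartAt E c`, i.e. its pullback by the inverse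
of this chart. -/
def chartRep (c : X) (θ : X → AltForm E k) : E → AltForm E k := fun y =>
  (θ ((chartAt E c).symm y)).compContinuousLinearMap
    (fderiv ℝ (chartAt E ((chartAt E c).symm y) ∘ (chartAt E c).symm) y)

/-- The image of `U` in the chart `chartAt E c`. -/
def chartDom (E : Type) [NormedAddCommGroup E] [NormedSpace ℂ E] [ChartedSpace E X] (c : X)
    (U : Opens X) : Set E :=
  (chartAt E c).target ∩ (chartAt E c).symm ⁻¹' U

/-- All expressions of `θ` in charts satisfy the local condition `P`. -/
def FormSat (P : ∀ {k : ℕ}, (E → AltForm E k) → E → Prop) {U : Opens X} (θ : U → AltForm E k) :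
    Prop :=
  ∀ (c : X), ∀ y ∈ chartDom E c U, P (chartRep c (extendZero θ)) y

/-- The exterior derivative `dθ`, computed at `x` in the preferred chart at `x`. By `chartRep_formD`
it is computed in any chart by the same formula. On holomorphic forms `d = ∂`, on antiholomorphic
forms `d = ∂̄`. -/
def formD {U : Opens X} (θ : U → AltForm E k) : U → AltForm E (k + 1) := fun x =>
  extDeriv (chartRep x.1 (extendZero θ)) (chartAt E x.1 x.1)

theorem isOpen_chartDom (c : X) (U : Opens X) : IsOpen (chartDom E c U) :=
  (chartAt E c).isOpen_inter_preimage_symm U.2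

theorem mem_chartDom_self {U : Opens X} (x : U) : chartAt E x.1 x.1 ∈ chartDom E x.1 U := by
  refine ⟨mem_chart_target E x.1, ?_⟩
  simp [(chartAt E x.1).left_inv (mem_chart_source E x.1)]

theorem chartRep_congr {U : Opens X} {θ θ' : X → AltForm E k} (h : ∀ x ∈ U, θ x = θ' x) (c : X)
    {y : E} (hy : y ∈ chartDom E c U) : chartRep c θ =ᶠ[𝓝 y] chartRep c θ' := by
  filter_upwards [(isOpen_chartDom c U).mem_nhds hy] with z hz
  simp only [chartRep, h _ hz.2]

theorem chartRep_restrict {U V : Opens X} (i : V ≤ U) (θ : U → AltForm E k) (c : X)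
    {y : E} (hy : y ∈ chartDom E c V) :
    chartRep c (extendZero fun x : V => θ ⟨x, i x.2⟩) =ᶠ[𝓝 y] chartRep c (extendZero θ) :=
  chartRep_congr (fun x hx => by rw [extendZero_apply _ hx, extendZero_apply _ (i hx)]) c hy

theorem chartRep_add (c : X) {U : Opens X} (θ θ' : U → AltForm E k) :
    chartRep c (extendZero (θ + θ')) = chartRep c (extendZero θ) + chartRep c (extendZero θ') := by
  have : extendZero (θ + θ') = extendZero θ + extendZero θ' := by
    ext x : 1
    by_cases hx : x ∈ U
    · simp [extendZero_apply _ hx]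
    · have : ¬ ∃ a : U, a.1 = x := by rintro ⟨a, rfl⟩; exact hx a.2
      simp [extendZero, Function.extend_apply' _ _ _ this]
  rw [this]; rfl

theorem chartRep_neg (c : X) {U : Opens X} (θ : U → AltForm E k) :
    chartRep c (extendZero (-θ)) = -chartRep c (extendZero θ) := by
  have : extendZero (-θ) = -extendZero θ := by
    ext x : 1
    by_cases hx : x ∈ U
    · simp [extendZero_apply _ hx]
    · have : ¬ ∃ a : U, a.1 = x := by rintro ⟨a, rfl⟩; exact hx a.2
      simp [extendZero, Function.extend_apply' _ _ _ this]
  rw [this]; rfl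

theorem chartRep_zero (c : X) {U : Opens X} :
    chartRep c (extendZero (0 : U → AltForm E k)) = 0 := by
  have : extendZero (0 : U → AltForm E k) = 0 := by
    ext x : 1
    by_cases hx : x ∈ U
    · simp [extendZero_apply _ hx]
    · have : ¬ ∃ a : U, a.1 = x := by rintro ⟨a, rfl⟩; exact hx a.2
      simp [extendZero, Function.extend_apply' _ _ _ this]
  rw [this]; rfl

theorem FormSat.contDiffAt {P : ∀ {k : ℕ}, (E → AltForm E k) → E → Prop} (hP : IsFormClass P)
    {U : Opens X} {θ : U → AltForm E k} (h : FormSat P θ) (c : X) (y : E)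
    (hy : y ∈ chartDom E c U) : ContDiffAt ℝ 2 (chartRep c (extendZero θ)) y :=
  hP.contDiffAt (h c y hy)

section
variable [IsManifold 𝓘(ℂ, E) ω X]

theorem contDiffAt_transition (c c' : X) {y : E} (hy : y ∈ (chartAt E c).target)
    (hy' : (chartAt E c).symm y ∈ (chartAt E c').source) :
    ContDiffAt ℝ 2 (chartAt E c' ∘ (chartAt E c).symm) y := by
  have h := HasGroupoid.compatible (G := contDiffGroupoid ω 𝓘(ℂ, E))
    (chart_mem_atlas E c) (chart_mem_atlas E c')
  rw [contDiffGroupoid, mem_groupoid_of_pregroupoid] at h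
  have h1 : ContDiffOn ℂ ω (chartAt E c' ∘ (chartAt E c).symm)
      ((chartAt E c).symm.trans (chartAt E c')).source := by
    simpa [contDiffPregroupoid] using h.1
  have h2 := h1.contDiffAt ((OpenPartialHomeomorph.open_source _).mem_nhds
    (show y ∈ _ by simpa using ⟨hy, hy'⟩))
  exact (h2.of_le le_top).restrict_scalars ℝ

theorem chartRep_formD {U : Opens X} {θ : U → AltForm E k}
    (hθ : ∀ (c : X), ∀ y ∈ chartDom E c U, ContDiffAt ℝ 2 (chartRep c (extendZero θ)) y)
    (c : X) {y : E} (hy : y ∈ chartDom E c U) :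
    chartRep c (extendZero (formD θ)) y = extDeriv (chartRep c (extendZero θ)) y := by
  set x := (chartAt E c).symm y with hx
  have hxs : x ∈ (chartAt E x).source := mem_chart_source E x
  set τ := chartAt E x ∘ (chartAt E c).symm with hτ
  have hτy : chartAt E x x = τ y := rfl
  have h1 : chartRep c (extendZero (formD θ)) y =
      (extDeriv (chartRep x (extendZero θ)) (τ y)).compContinuousLinearMap (fderiv ℝ τ y) := by
    simp only [chartRep, ← hx]
    rw [extendZero_apply _ hy.2]
    rfl
  have hsm : ContDiffAt ℝ 2 τ y := contDiffAt_transition c x hy.1 hxs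
  have hd : τ y ∈ chartDom E x U := mem_chartDom_self (⟨x, hy.2⟩ : U)
  rw [h1, ← extDeriv_pullback ((hθ x _ hd).differentiableAt two_ne_zero) hsm (by simp)]
  refine Filter.EventuallyEq.extDeriv_eq ?_
  have ho : IsOpen ((chartAt E c).symm.trans (chartAt E x)).source := OpenPartialHomeomorph.open_source _
  filter_upwards [ho.mem_nhds (show y ∈ _ by simpa using ⟨hy.1, hxs⟩)] with z hz
  simp only [OpenPartialHomeomorph.trans_source, OpenPartialHomeomorph.symm_source, Set.mem_inter_iff,
    Set.mem_preimage] at hz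
  have hw : (chartAt E x).symm (τ z) = (chartAt E c).symm z := (chartAt E x).left_inv hz.2
  simp only [chartRep, hw]
  have hzU : (chartAt E c).symm z ∈ (chartAt E ((chartAt E c).symm z)).source := mem_chart_source E _
  have d1 : DifferentiableAt ℝ τ z :=
    (contDiffAt_transition c x hz.1 hz.2).differentiableAt two_ne_zero
  have d2 : DifferentiableAt ℝ (chartAt E ((chartAt E c).symm z) ∘ (chartAt E x).symm) (τ z) :=
    (contDiffAt_transition x _ ((chartAt E x).map_source hz.2)
      (by rw [(chartAt E x).left_inv hz.2]; exact hzU)).differentiableAt two_ne_zero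
  have e : (chartAt E ((chartAt E c).symm z) ∘ (chartAt E x).symm) ∘ τ =ᶠ[𝓝 z]
      chartAt E ((chartAt E c).symm z) ∘ (chartAt E c).symm := by
    filter_upwards [ho.mem_nhds (show z ∈ _ by simpa using hz)] with w hw'
    simp only [OpenPartialHomeomorph.trans_source, OpenPartialHomeomorph.symm_source,
      Set.mem_inter_iff, Set.mem_preimage] at hw'
    simp only [Function.comp_apply, hτ, (chartAt E x).left_inv hw'.2]
  rw [← e.fderiv_eq, fderiv_comp z d2 d1]
  rfl

theorem chartRep_formD_eventuallyEq {P : ∀ {k : ℕ}, (E → AltForm E k) → E → Prop}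
    (hP : IsFormClass P) {U : Opens X} {θ : U → AltForm E k} (h : FormSat P θ) (c : X) {y : E}
    (hy : y ∈ chartDom E c U) :
    chartRep c (extendZero (formD θ)) =ᶠ[𝓝 y] extDeriv (chartRep c (extendZero θ)) := by
  filter_upwards [(isOpen_chartDom c U).mem_nhds hy] with z hz
  exact chartRep_formD (h.contDiffAt hP) c hz

theorem FormSat.formD {P : ∀ {k : ℕ}, (E → AltForm E k) → E → Prop} (hP : IsFormClass P)
    {U : Opens X} {θ : U → AltForm E k} (h : FormSat P θ) : FormSat P (formD θ) := fun c y hy =>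
  hP.congr (hP.extDeriv (h c y hy)) (chartRep_formD_eventuallyEq hP h c hy)

theorem FormSat.formD_formD {P : ∀ {k : ℕ}, (E → AltForm E k) → E → Prop} (hP : IsFormClass P)
    {U : Opens X} {θ : U → AltForm E k} (h : FormSat P θ) : BottChern.formD (BottChern.formD θ) = 0 := by
  funext x
  have hx := mem_chartDom_self (E := E) x
  change extDeriv (chartRep x.1 (extendZero (BottChern.formD θ))) (chartAt E x.1 x.1) = 0
  rw [(chartRep_formD_eventuallyEq hP h x.1 hx).extDeriv_eq]
  exact extDeriv_extDeriv_apply (h.contDiffAt hP x.1 _ hx) (by simp)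

end

theorem FormSat.formD_add {P : ∀ {k : ℕ}, (E → AltForm E k) → E → Prop} (hP : IsFormClass P)
    {U : Opens X} {θ θ' : U → AltForm E k} (h : FormSat P θ) (h' : FormSat P θ') :
    BottChern.formD (θ + θ') = BottChern.formD θ + BottChern.formD θ' := by
  funext x
  have hx := mem_chartDom_self (E := E) x
  simp only [BottChern.formD, chartRep_add, Pi.add_apply]
  exact extDeriv_add ((h.contDiffAt hP _ _ hx).differentiableAt two_ne_zero)
    ((h'.contDiffAt hP _ _ hx).differentiableAt two_ne_zero)

theorem formD_restrict {U V : Opens X} (i : V ≤ U) (θ : U → AltForm E k) (x : V) :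
    formD (fun x : V => θ ⟨x, i x.2⟩) x = formD θ ⟨x, i x.2⟩ :=
  (chartRep_restrict i θ x.1 (mem_chartDom_self x)).extDeriv_eq

/-- The sheaf of forms of degree `k` satisfying `P`, replaced by `0` if `k ≥ r`. -/
def formSections (X : Type u) [TopologicalSpace X] [ChartedSpace E X]
    (P : ∀ {k : ℕ}, (E → AltForm E k) → E → Prop) (hP : IsFormClass P)
    (r k : ℕ) : LocalSections X (AltForm E k) where
  sec U :=
    { carrier := {θ | FormSat P θ ∧ (r ≤ k → θ = 0)}
      zero_mem' := ⟨fun c y _ => by rw [chartRep_zero]; exact hP.zero y, fun _ => rfl⟩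
      add_mem' := fun {a b} ha hb =>
        ⟨fun c y hy => by rw [chartRep_add]; exact hP.add (ha.1 c y hy) (hb.1 c y hy),
          fun hr => by rw [ha.2 hr, hb.2 hr, add_zero]⟩
      neg_mem' := fun {a} ha =>
        ⟨fun c y hy => by rw [chartRep_neg]; exact hP.neg (ha.1 c y hy),
          fun hr => by rw [ha.2 hr, neg_zero]⟩ }
  res {U V} i θ h :=
    ⟨fun c y hy => hP.congr (h.1 c y ⟨hy.1, i hy.2⟩) (chartRep_restrict i θ c hy),
      fun hr => by rw [h.2 hr]; rfl⟩
  loc U θ h := by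
    refine ⟨fun c y hy => ?_, fun hr => ?_⟩
    · obtain ⟨V, i, hV, h1, -⟩ := h ⟨_, hy.2⟩
      exact hP.congr (h1 c y ⟨hy.1, hV⟩) (chartRep_restrict i θ c ⟨hy.1, hV⟩).symm
    · funext x
      obtain ⟨V, i, hV, -, h2⟩ := h x
      exact congrFun (h2 hr) ⟨x, hV⟩

variable [IsManifold 𝓘(ℂ, E) ω X]

/-- The exterior derivative, from degree `k` to degree `k + 1`, of the complex of forms truncated to
degrees `< r`. -/
def truncD (P : ∀ {k : ℕ}, (E → AltForm E k) → E → Prop) (hP : IsFormClass P)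
    (r k : ℕ) (U : Opens X) :
    (formSections X P hP r k).sec U →+ (formSections X P hP r (k + 1)).sec U where
  toFun θ := ⟨if k + 1 < r then formD θ.1 else 0, by
    split_ifs with hr
    · exact ⟨θ.2.1.formD hP, fun hr' => absurd hr (not_lt.2 hr')⟩
    · exact AddSubgroup.zero_mem _⟩
  map_zero' := Subtype.ext <| by
    dsimp only
    split_ifs with hr
    · have h := FormSat.formD_add hP ((formSections X P hP r k).sec U).zero_mem.1
        ((formSections X P hP r k).sec U).zero_mem.1
      rw [add_zero] at h
      exact left_eq_add.1 h
    · rfl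
  map_add' θ θ' := Subtype.ext <| by
    dsimp only
    split_ifs with hr
    · exact FormSat.formD_add hP θ.2.1 θ'.2.1
    · exact (add_zero _).symm

theorem truncD_truncD (P : ∀ {k : ℕ}, (E → AltForm E k) → E → Prop) (hP : IsFormClass P)
    (r k : ℕ) (U : Opens X) (θ : (formSections X P hP r k).sec U) :
    truncD P hP r (k + 1) U (truncD P hP r k U θ) = 0 := Subtype.ext <| by
  change (if k + 1 + 1 < r then formD (if k + 1 < r then formD θ.1 else 0) else 0) = 0
  by_cases hr : k + 1 + 1 < r
  · rw [if_pos hr, if_pos (by omega)]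
    exact θ.2.1.formD_formD hP
  · rw [if_neg hr]

theorem truncD_restrict (P : ∀ {k : ℕ}, (E → AltForm E k) → E → Prop) (hP : IsFormClass P)
    (r k : ℕ) {U V : Opens X} (i : V ≤ U) (θ : (formSections X P hP r k).sec U) (x : V) :
    (truncD P hP r k V ⟨fun x => θ.1 ⟨x, i x.2⟩, (formSections X P hP r k).res i θ.1 θ.2⟩).1 x =
      (truncD P hP r k U θ).1 ⟨x, i x.2⟩ := by
  change (if k + 1 < r then formD (fun x : V => θ.1 ⟨x, i x.2⟩) else 0) x =
    (if k + 1 < r then formD θ.1 else 0) ⟨x, i x.2⟩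
  split_ifs with hr
  · exact formD_restrict i θ.1 x
  · rfl

end Forms

section Complexes

variable (E : Type) [NormedAddCommGroup E] [NormedSpace ℂ E]
variable (X : Type u) [TopologicalSpace X] [ChartedSpace E X]

/-- The sheaf `Ω^k` of holomorphic `k`-forms if `k < r`, and `0` if `k ≥ r`. -/
def holSections (r k : ℕ) : LocalSections X (AltForm E k) :=
  formSections X HolAt isFormClass_holAt r k

/-- The sheaf of antiholomorphic `k`-forms if `k < r`, and `0` if `k ≥ r`. -/
def antiHolSections (r k : ℕ) : LocalSections X (AltForm E k) :=
  formSections X AntiHolAt isFormClass_antiHolAt r k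

theorem holAt_const (c : ℂ) (y : E) :
    HolAt (fun _ : E => ContinuousAlternatingMap.constOfIsEmpty ℝ E (Fin 0) c) y :=
  ⟨fun _ => ContinuousAlternatingMap.constOfIsEmpty ℂ E (Fin 0) c, analyticAt_const,
    Filter.Eventually.of_forall fun _ => rfl⟩

theorem antiHolAt_const (c : ℂ) (y : E) :
    AntiHolAt (fun _ : E => ContinuousAlternatingMap.constOfIsEmpty ℝ E (Fin 0) c) y :=
  holAt_const E (starRingEnd ℂ c) y

variable {X} in
theorem chartRep_const {U : Opens X} (f : U → ℂ) (hf : IsLocallyConstant f)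
    (c : X) {y : E} (hy : y ∈ chartDom E c U) :
    chartRep c (extendZero fun x => ContinuousAlternatingMap.constOfIsEmpty ℝ E (Fin 0) (f x))
      =ᶠ[𝓝 y] fun _ => ContinuousAlternatingMap.constOfIsEmpty ℝ E (Fin 0) (f ⟨_, hy.2⟩) := by
  have hlc : ∀ᶠ x in 𝓝 (⟨_, hy.2⟩ : U), f x = f ⟨_, hy.2⟩ :=
    (IsLocallyConstant.iff_eventually_eq f).1 hf _
  rw [nhds_subtype_eq_comap, Filter.eventually_comap] at hlc
  have hcont := ((chartAt E c).continuousAt_symm hy.1).eventually hlc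
  filter_upwards [hcont, (isOpen_chartDom c U).mem_nhds hy] with z hz hzU
  rw [← hz ⟨_, hzU.2⟩ rfl, chartRep, extendZero_apply _ hzU.2]
  rfl

variable (A : AddSubgroup ℂ)

/-- A locally constant function, viewed as a form of degree `0` (and sent to `0` if `r = 0`). -/
def constToForms (P : ∀ {k : ℕ}, (E → AltForm E k) → E → Prop) (hP : IsFormClass P)
    (hc : ∀ (c : ℂ) (y : E),
      P (fun _ : E => ContinuousAlternatingMap.constOfIsEmpty ℝ E (Fin 0) c) y)
    (r : ℕ) (U : Opens X) :
    (LocalSections.const X A).sec U →+ (formSections X P hP r 0).sec U where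
  toFun f := ⟨if 0 < r then
      fun x => ContinuousAlternatingMap.constOfIsEmpty ℝ E (Fin 0) (f.1 x) else 0, by
    split_ifs with hr
    · exact ⟨fun c y hy => hP.congr (hc _ y) (chartRep_const E f.1 f.2.1 c hy),
        fun hr' => absurd hr (not_lt.2 hr')⟩
    · exact AddSubgroup.zero_mem _⟩
  map_zero' := Subtype.ext <| by
    dsimp only
    split_ifs with hr
    · funext x; ext v; rfl
    · rfl
  map_add' f g := Subtype.ext <| by
    dsimp only
    split_ifs with hr
    · funext x; ext v; rfl
    · exact (add_zero _).symm

theorem constToForms_restrict (P : ∀ {k : ℕ}, (E → AltForm E k) → E → Prop) (hP : IsFormClass P)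
    (hc : ∀ (c : ℂ) (y : E),
      P (fun _ : E => ContinuousAlternatingMap.constOfIsEmpty ℝ E (Fin 0) c) y)
    (r : ℕ) {U V : Opens X} (i : V ≤ U) (f : (LocalSections.const X A).sec U) (x : V) :
    (constToForms E X A P hP hc r V
      ⟨fun x => f.1 ⟨x, i x.2⟩, (LocalSections.const X A).res i f.1 f.2⟩).1 x =
      (constToForms E X A P hP hc r U f).1 ⟨x, i x.2⟩ := by
  change (if 0 < r then
    fun x : V => ContinuousAlternatingMap.constOfIsEmpty ℝ E (Fin 0) (f.1 ⟨x, i x.2⟩) else 0) x =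
    (if 0 < r then
      fun x => ContinuousAlternatingMap.constOfIsEmpty ℝ E (Fin 0) (f.1 x) else 0) ⟨x, i x.2⟩
  split_ifs <;> rfl

variable [IsManifold 𝓘(ℂ, E) ω X]

theorem truncD_constToForms (P : ∀ {k : ℕ}, (E → AltForm E k) → E → Prop) (hP : IsFormClass P)
    (hc : ∀ (c : ℂ) (y : E),
      P (fun _ : E => ContinuousAlternatingMap.constOfIsEmpty ℝ E (Fin 0) c) y)
    (r : ℕ) (U : Opens X) (f : (LocalSections.const X A).sec U) :
    truncD P hP r 0 U (constToForms E X A P hP hc r U f) = 0 := Subtype.ext <| by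
  change (if 0 + 1 < r then formD (if 0 < r then
    fun x => ContinuousAlternatingMap.constOfIsEmpty ℝ E (Fin 0) (f.1 x) else 0) else 0) = 0
  by_cases hr : 0 + 1 < r
  · rw [if_pos hr, if_pos (by omega)]
    funext x
    rw [formD, (chartRep_const E f.1 f.2.1 x.1 (mem_chartDom_self x)).extDeriv_eq,
      extDeriv_constOfIsEmpty]
    ext v
    simp
  · rw [if_neg hr]

/-- The terms of the complex of sheaves
`A → 𝒪 ⊕ 𝒪̄ → Ω¹ ⊕ Ω̄¹ → ⋯`, with `A` in degree `0`, where `Ω^k` appears (in degree `k + 1`) for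
`k ≤ p - 1` and `Ω̄^k` for `k ≤ q - 1`. -/
def bcObj (p q : ℕ) : ℕ → Sheaf (Opens.grothendieckTopology (TopCat.of X)) AddCommGrpCat.{u}
  | 0 => (LocalSections.const X A).sheaf
  | k + 1 => ((holSections E X p k).prod (antiHolSections E X q k)).sheaf

/-- The differential: `a ↦ (a, -a)` in degree `0`, and `(u, v) ↦ (∂u, ∂̄v)` in positive degrees. -/
def bcD (p q : ℕ) : ∀ k : ℕ, bcObj E X A p q k ⟶ bcObj E X A p q (k + 1)
  | 0 => LocalSections.homMk
      (fun U => LocalSections.prodMk.comp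
        ((constToForms E X A HolAt isFormClass_holAt (holAt_const E) p U).prod
          (-constToForms E X A AntiHolAt isFormClass_antiHolAt (antiHolAt_const E) q U)))
      (fun _ _ i f x => Prod.ext
        (constToForms_restrict E X A HolAt isFormClass_holAt (holAt_const E) p i f x)
        (congrArg Neg.neg
          (constToForms_restrict E X A AntiHolAt isFormClass_antiHolAt (antiHolAt_const E) q i f x)))
  | k + 1 => LocalSections.homMk
      (fun U => LocalSections.prodMk.comp
        (((truncD HolAt isFormClass_holAt p k U).comp LocalSections.prodFst).prod
          ((truncD AntiHolAt isFormClass_antiHolAt q k U).comp LocalSections.prodSnd)))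
      (fun _ _ i f x => Prod.ext
        (truncD_restrict HolAt isFormClass_holAt p k i (LocalSections.prodFst f) x)
        (truncD_restrict AntiHolAt isFormClass_antiHolAt q k i (LocalSections.prodSnd f) x))

theorem bcD_bcD (p q k : ℕ) : bcD E X A p q k ≫ bcD E X A p q (k + 1) = 0 := by
  cases k with
  | zero =>
    refine LocalSections.homMk_comp_homMk _ _ _ _ fun U f => Subtype.ext (funext fun x => ?_)
    have h1 := truncD_constToForms E X A HolAt isFormClass_holAt (holAt_const E) p U f
    have h2 := truncD_constToForms E X A AntiHolAt isFormClass_antiHolAt (antiHolAt_const E) q U f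
    have h3 : truncD AntiHolAt isFormClass_antiHolAt q 0 U
      (-constToForms E X A AntiHolAt isFormClass_antiHolAt (antiHolAt_const E) q U f) = 0 := by
      rw [map_neg, h2, neg_zero]
    exact Prod.ext (congrFun (congrArg Subtype.val h1) x) (congrFun (congrArg Subtype.val h3) x)
  | succ k =>
    refine LocalSections.homMk_comp_homMk _ _ _ _ fun U w => Subtype.ext (funext fun x => ?_)
    exact Prod.ext
      (congrFun (congrArg Subtype.val (truncD_truncD HolAt isFormClass_holAt p k U
        (LocalSections.prodFst w))) x)
      (congrFun (congrArg Subtype.val (truncD_truncD AntiHolAt isFormClass_antiHolAt q k U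
        (LocalSections.prodSnd w))) x)

/-- The complex of sheaves `bcObj`, indexed by `ℕ`. -/
def bcComplexNat (p q : ℕ) :
    CochainComplex (Sheaf (Opens.grothendieckTopology (TopCat.of X)) AddCommGrpCat.{u}) ℕ :=
  CochainComplex.of (bcObj E X A p q) (bcD E X A p q) (bcD_bcD E X A p q)

/-- The complex `𝓑_{p,q}` with the subgroup `A` of `ℂ` placed in degree `0`:
`A → 𝒪 ⊕ 𝒪̄ → Ω¹ ⊕ Ω̄¹ → ⋯`, indexed by `ℤ` (zero in negative degrees). -/
def bcComplex (p q : ℕ) :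
    CochainComplex (Sheaf (Opens.grothendieckTopology (TopCat.of X)) AddCommGrpCat.{u}) ℤ :=
  (bcComplexNat E X A p q).extend ComplexShape.embeddingUpNat

/-- The projection of the complex onto its term of degree `0`, the constant sheaf `A`. -/
def bcToConst (p q : ℕ) :
    bcComplex E X A p q ⟶
      (CochainComplex.singleFunctor _ 0).obj (LocalSections.const X A).sheaf :=
  HomologicalComplex.extendMap ((CochainComplex.toSingle₀Equiv _ _).symm (𝟙 _)) _ ≫
    (HomologicalComplex.extendSingleIso ComplexShape.embeddingUpNat _ 0 0 rfl).hom

variable {A} {B : AddSubgroup ℂ}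

/-- The inclusion induced by `A ≤ B` in degree `0`, the identity in positive degrees. -/
def bcObjIncl (h : A ≤ B) (p q : ℕ) : ∀ k : ℕ, bcObj E X A p q k ⟶ bcObj E X B p q k
  | 0 => LocalSections.constIncl X h
  | _ + 1 => 𝟙 _

theorem bcObjIncl_comm (h : A ≤ B) (p q k : ℕ) :
    bcObjIncl E X h p q k ≫ bcD E X B p q k = bcD E X A p q k ≫ bcObjIncl E X h p q (k + 1) := by
  cases k with
  | zero => rfl
  | succ k => simp [bcObjIncl]; rfl

/-- The morphism of complexes induced by an inclusion `A ≤ B` of coefficient groups. -/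
def bcIncl (h : A ≤ B) (p q : ℕ) : bcComplex E X A p q ⟶ bcComplex E X B p q :=
  HomologicalComplex.extendMap
    (CochainComplex.ofHom (X := bcComplexNat E X A p q) (Y := bcComplexNat E X B p q)
      (bcObjIncl E X h p q) fun k => by
        simpa [bcComplexNat] using bcObjIncl_comm E X h p q k) _

end Complexes

section Hypercohomology

variable {X : Type u} [TopologicalSpace X]

/-- The (standard) derived category of sheaves of abelian groups on `X`. -/
instance : HasDerivedCategory
    (Sheaf (Opens.grothendieckTopology (TopCat.of X)) AddCommGrpCat.{u}) :=
  HasDerivedCategory.standard _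

/-- The hypercohomology group `ℍⁿ(X, K) = Hom_{D(X)}(ℤ_X, K[n])`. -/
abbrev Hyper
    (K : CochainComplex (Sheaf (Opens.grothendieckTopology (TopCat.of X)) AddCommGrpCat.{u}) ℤ)
    (n : ℤ) : Type (u + 1) :=
  ShiftedHom ((DerivedCategory.singleFunctor _ 0).obj
    ((constantSheaf (Opens.grothendieckTopology (TopCat.of X)) AddCommGrpCat.{u}).obj
      (AddCommGrpCat.of (ULift ℤ)))) (DerivedCategory.Q.obj K) n

/-- The map induced on hypercohomology by a morphism of complexes of sheaves. -/
def Hyper.map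
    {K L : CochainComplex (Sheaf (Opens.grothendieckTopology (TopCat.of X)) AddCommGrpCat.{u}) ℤ}
    (f : K ⟶ L) (n : ℤ) : Hyper K n →+ Hyper L n :=
  Preadditive.rightComp _ ((DerivedCategory.Q.map f)⟦n⟧')

/-- The hypercohomology of a sheaf placed in degree `0` is its cohomology. -/
def Hyper.single
    (F : Sheaf (Opens.grothendieckTopology (TopCat.of X)) AddCommGrpCat.{u}) (n : ℕ) :
    Hyper ((CochainComplex.singleFunctor _ 0).obj F) n ≃+ Sheaf.H.{u} F n :=
  Abelian.Ext.homAddEquiv.symm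

end Hypercohomology

section Groups

/-- The subgroup `ℤ(p) = (2πi)^p ℤ` of `ℂ`. -/
def tateZ (p : ℕ) : AddSubgroup ℂ :=
  AddSubgroup.zmultiples ((2 * (Real.pi : ℂ) * Complex.I) ^ p)

/-- The cohomology `H^k(X, A)` of `X` with values in the constant sheaf `A`, for `A ≤ ℂ`. -/
abbrev ConstH (X : Type u) [TopologicalSpace X] (A : AddSubgroup ℂ) (k : ℕ) : Type u :=
  Sheaf.H.{u} (LocalSections.const X A).sheaf k

/-- The map `ε : H^k(X, ℤ(p)) → H^k(X, ℂ)`. -/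
def eps (X : Type u) [TopologicalSpace X] (p k : ℕ) : ConstH X (tateZ p) k →+ ConstH X ⊤ k :=
  Sheaf.H.map (LocalSections.constIncl X (le_top : tateZ p ≤ ⊤)) k

variable (E : Type) [NormedAddCommGroup E] [NormedSpace ℂ E]
variable (X : Type u) [TopologicalSpace X] [ChartedSpace E X] [IsManifold 𝓘(ℂ, E) ω X]

/-- The Bott-Chern group `H^{p,q}_BC(X, ℂ) = ℍ^{p+q}(X, 𝓑_{p,q})`. -/
abbrev BCGroupC (p q : ℕ) : Type (u + 1) :=
  Hyper (bcComplex E X ⊤ p q) ((p + q : ℕ) : ℤ)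

/-- The integral Bott-Chern group `H^{p,q}_BC(X, ℤ)`: the hypercohomology in degree `p + q` of the
complex `𝓑_{p,q}` with `ℂ` replaced by `ℤ(p)`. -/
abbrev BCGroupZ (p q : ℕ) : Type (u + 1) :=
  Hyper (bcComplex E X (tateZ p) p q) ((p + q : ℕ) : ℤ)

/-- The natural map `ε_BC : H^{p,q}_BC(X, ℤ) → H^{p,q}_BC(X, ℂ)`. -/
def epsBC (p q : ℕ) : BCGroupZ E X p q →+ BCGroupC E X p q :=
  Hyper.map (bcIncl E X le_top p q) _

/-- The map `φ : H^{p,q}_BC(X, ℂ) → H^{p+q}(X, ℂ)` induced by the projection `𝓑_{p,q} → ℂ`. -/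
def phi (p q : ℕ) : BCGroupC E X p q →+ ConstH X ⊤ (p + q) :=
  (Hyper.single _ _).toAddMonoidHom.comp (Hyper.map (bcToConst E X ⊤ p q) _)

/-- The map `φ_ℤ : H^{p,q}_BC(X, ℤ) → H^{p+q}(X, ℤ(p))` induced by the projection onto degree `0`. -/
def phiInt (p q : ℕ) : BCGroupZ E X p q →+ ConstH X (tateZ p) (p + q) :=
  (Hyper.single _ _).toAddMonoidHom.comp (Hyper.map (bcToConst E X (tateZ p) p q) _)

end Groups

end

end BottChern

/-! Write `B_A` for the Bott–Chern complex with coefficients `A`, and take `A = ℤ(p)` or `ℂ`. The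
inclusion `B_ℤ(p) → B_ℂ`, the inclusion `ℤ(p)[0] → ℂ[0]` and the projections to degree `0` form a
commutative square of complexes. In degree `0` both projections are isomorphisms; in every other
degree both inclusions are. Such a square is bicartesian in each degree, so `0 → B_ℤ(p) → B_ℂ ⊞
ℤ(p)[0] → ℂ[0] → 0` is exact (`shortExact_of_square`), and applying `Hom(ℤ_X, -)` in the derived
category gives a Mayer–Vietoris sequence.

Exactness at the middle term is the existence of the lift with prescribed images
(`exists_pushHom_of_square`).

The ambiguity of the lift is the image of the connecting map, that is, `H^{p+q-1}(X, ℂ)` modulo the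
images of `ℍ^{p+q-1}(X, B_ℂ)` and `H^{p+q-1}(X, ℤ(p))` (`exists_connecting_of_square`). For `p = 1`,
`q = 0` this concerns degree `0`. There the first image is zero, because a locally constant function
that vanishes in `𝒪` is zero (`section_bcToConst_eq_zero`), and the second consists of functions
with values in `2πiℤ` (`section_constIncl`). So the constant `1` has nonzero image under the
connecting map, on any nonempty `X`; taking `X = ℂⁿ` gives the example. -/

namespace BottChern

open CategoryTheory Limits

/-! ### Mayer–Vietoris for a square of complexes with parallel isomorphisms in each degree -/

section MayerVietoris

variable {C : Type*} [Category* C] [Abelian C]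
variable {X₁ X₂ X₃ X₄ : CochainComplex C ℤ}
  {t : X₁ ⟶ X₂} {l : X₁ ⟶ X₃} {r : X₂ ⟶ X₄} {b : X₃ ⟶ X₄}

theorem biprod_lift_desc_neg_eq_zero (w : t ≫ r = l ≫ b) :
    biprod.lift t l ≫ biprod.desc r (-b) = 0 := by
  simp [w]

theorem biprod_total_f (Y Z : CochainComplex C ℤ) (i : ℤ) :
    (biprod.fst : Y ⊞ Z ⟶ Y).f i ≫ (biprod.inl : Y ⟶ Y ⊞ Z).f i +
      (biprod.snd : Y ⊞ Z ⟶ Z).f i ≫ (biprod.inr : Z ⟶ Y ⊞ Z).f i = 𝟙 _ := by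
  rw [← HomologicalComplex.comp_f, ← HomologicalComplex.comp_f, ← HomologicalComplex.add_f_apply,
    biprod.total, HomologicalComplex.id_f]

/-- Exactness is checked degree by degree. A commutative square in which one pair of parallel sides
is invertible is both a pullback and a pushout; which pair it is may vary with the degree. -/
theorem shortExact_of_square (w : t ≫ r = l ≫ b)
    (h : ∀ i, (IsIso (t.f i) ∧ IsIso (b.f i)) ∨ (IsIso (l.f i) ∧ IsIso (r.f i))) :
    (ShortComplex.mk _ _ (biprod_lift_desc_neg_eq_zero w)).ShortExact := by
  refine HomologicalComplex.shortExact_of_degreewise_shortExact _ fun i => ?_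
  have wi : t.f i ≫ r.f i = l.f i ≫ b.f i := by simpa using HomologicalComplex.congr_hom w i
  have h₁ : (biprod.lift t l).f i ≫ (biprod.fst : X₂ ⊞ X₃ ⟶ X₂).f i = t.f i := by
    simp [← HomologicalComplex.comp_f]
  have h₂ : (biprod.lift t l).f i ≫ (biprod.snd : X₂ ⊞ X₃ ⟶ X₃).f i = l.f i := by
    simp [← HomologicalComplex.comp_f]
  have h₃ : (biprod.inl : X₂ ⟶ X₂ ⊞ X₃).f i ≫ (biprod.desc r (-b)).f i = r.f i := by
    simp [← HomologicalComplex.comp_f]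
  have h₄ : (biprod.inr : X₃ ⟶ X₂ ⊞ X₃).f i ≫ (biprod.desc r (-b)).f i = -b.f i := by
    simp [← HomologicalComplex.comp_f]
  have htot := biprod_total_f X₂ X₃ i
  have hdesc : (biprod.desc r (-b)).f i = (biprod.fst : X₂ ⊞ X₃ ⟶ X₂).f i ≫ r.f i -
      (biprod.snd : X₂ ⊞ X₃ ⟶ X₃).f i ≫ b.f i := by
    rw [← Category.id_comp ((biprod.desc r (-b)).f i), ← htot, Preadditive.add_comp,
      Category.assoc, Category.assoc, h₃, h₄, Preadditive.comp_neg, sub_eq_add_neg]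
  have hlift : (biprod.lift t l).f i = t.f i ≫ (biprod.inl : X₂ ⟶ X₂ ⊞ X₃).f i +
      l.f i ≫ (biprod.inr : X₃ ⟶ X₂ ⊞ X₃).f i := by
    rw [← Category.comp_id ((biprod.lift t l).f i), ← htot, Preadditive.comp_add,
      reassoc_of% h₁, reassoc_of% h₂]
  -- In each degree one of `t`, `l` is invertible, hence mono, and it factors through the lift;
  -- dually, one of `r`, `b` makes the second map epi.
  have hmono : Mono ((biprod.lift t l).f i) := by
    rcases h i with ⟨_, _⟩ | ⟨_, _⟩
    · exact mono_of_mono_fac h₁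
    · exact mono_of_mono_fac h₂
  have hepi : Epi ((biprod.desc r (-b)).f i) := by
    rcases h i with ⟨_, _⟩ | ⟨_, _⟩
    · exact epi_of_epi_fac h₄
    · exact epi_of_epi_fac h₃
  refine { exact := ?_, mono_f := hmono, epi_g := hepi }
  rw [ShortComplex.exact_iff_exact_up_to_refinements]
  intro A (x : A ⟶ (X₂ ⊞ X₃).X i) (hx : x ≫ (biprod.desc r (-b)).f i = 0)
  have hx' : (x ≫ (biprod.fst : X₂ ⊞ X₃ ⟶ X₂).f i) ≫ r.f i =
      (x ≫ (biprod.snd : X₂ ⊞ X₃ ⟶ X₃).f i) ≫ b.f i := by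
    rw [hdesc, Preadditive.comp_sub, sub_eq_zero] at hx
    simpa using hx
  -- The pullback property: lift along whichever of `t`, `l` is invertible, then check the other
  -- equation after composing with the opposite side of the square, which is mono.
  have key : ∃ y : A ⟶ X₁.X i, y ≫ t.f i = x ≫ (biprod.fst : X₂ ⊞ X₃ ⟶ X₂).f i ∧
      y ≫ l.f i = x ≫ (biprod.snd : X₂ ⊞ X₃ ⟶ X₃).f i := by
    rcases h i with ⟨_, _⟩ | ⟨_, _⟩
    · refine ⟨(x ≫ (biprod.fst : X₂ ⊞ X₃ ⟶ X₂).f i) ≫ inv (t.f i), by simp, ?_⟩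
      rw [← cancel_mono (b.f i), ← hx', Category.assoc, Category.assoc, ← wi, IsIso.inv_hom_id_assoc]
    · refine ⟨(x ≫ (biprod.snd : X₂ ⊞ X₃ ⟶ X₃).f i) ≫ inv (l.f i), ?_, by simp⟩
      rw [← cancel_mono (r.f i), hx', Category.assoc, Category.assoc, wi, IsIso.inv_hom_id_assoc]
  obtain ⟨y, hy₁, hy₂⟩ := key
  -- The lift exists on `A` itself, so the refinement is the identity.
  refine ⟨A, 𝟙 A, inferInstance, y, ?_⟩
  change 𝟙 A ≫ x = y ≫ (biprod.lift t l).f i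
  rw [hlift, Preadditive.comp_add, reassoc_of% hy₁, reassoc_of% hy₂, Category.id_comp,
    ← Preadditive.comp_add, htot, Category.comp_id]

/-! ### Long exact sequences of morphisms from a fixed object of the derived category -/

variable [HasDerivedCategory C] (A : DerivedCategory C) (n : ℤ)

/-- The map induced by a morphism of complexes on morphisms from `A` in the derived category. -/
noncomputable def pushHom {K L : CochainComplex C ℤ} (f : K ⟶ L) :
    (A ⟶ (DerivedCategory.Q.obj K)⟦n⟧) →+ (A ⟶ (DerivedCategory.Q.obj L)⟦n⟧) :=
  Preadditive.rightComp _ ((DerivedCategory.Q.map f)⟦n⟧')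

theorem pushHom_apply {K L : CochainComplex C ℤ} (f : K ⟶ L)
    (x : A ⟶ (DerivedCategory.Q.obj K)⟦n⟧) :
    pushHom A n f x = x ≫ (DerivedCategory.Q.map f)⟦n⟧' := rfl

theorem pushHom_comp {K L M : CochainComplex C ℤ} (f : K ⟶ L) (g : L ⟶ M)
    (x : A ⟶ (DerivedCategory.Q.obj K)⟦n⟧) :
    pushHom A n (f ≫ g) x = pushHom A n g (pushHom A n f x) := by
  simp [pushHom_apply]

theorem pushHom_id {K : CochainComplex C ℤ} (x : A ⟶ (DerivedCategory.Q.obj K)⟦n⟧) :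
    pushHom A n (𝟙 K) x = x := by
  simp [pushHom_apply]

theorem pushHom_add {K L : CochainComplex C ℤ} (f g : K ⟶ L)
    (x : A ⟶ (DerivedCategory.Q.obj K)⟦n⟧) :
    pushHom A n (f + g) x = pushHom A n f x + pushHom A n g x := by
  simp [pushHom_apply, Functor.map_add]

theorem pushHom_zero {K L : CochainComplex C ℤ} (x : A ⟶ (DerivedCategory.Q.obj K)⟦n⟧) :
    pushHom A n (0 : K ⟶ L) x = 0 := by
  simp [pushHom_apply]

theorem pushHom_eq_zero_of_homotopy {K L : CochainComplex C ℤ} {f : K ⟶ L} (h : Homotopy f 0)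
    (x : A ⟶ (DerivedCategory.Q.obj K)⟦n⟧) : pushHom A n f x = 0 := by
  rw [pushHom_apply, DerivedCategory.Q_map_eq_of_homotopy C h]
  simp

theorem pushHom_desc {Y Z : CochainComplex C ℤ} {W : CochainComplex C ℤ} (r : Y ⟶ W) (b : Z ⟶ W)
    (x : A ⟶ (DerivedCategory.Q.obj (Y ⊞ Z))⟦n⟧) :
    pushHom A n (biprod.desc r (-b)) x =
      pushHom A n r (pushHom A n biprod.fst x) - pushHom A n b (pushHom A n biprod.snd x) := by
  have h : biprod.desc r (-b) + biprod.snd ≫ b = biprod.fst ≫ r := by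
    apply biprod.hom_ext' <;> simp
  rw [eq_sub_iff_add_eq, ← pushHom_comp, ← pushHom_comp, ← pushHom_add, h]

variable {A n}

/-- A short exact sequence of complexes gives a distinguished triangle, and `Hom(A, -)` is a
homological functor. -/
theorem exists_pushHom_eq {f : X₁ ⟶ X₂} {g : X₂ ⟶ X₃} {w : f ≫ g = 0}
    (hS : (ShortComplex.mk f g w).ShortExact)
    (x : A ⟶ (DerivedCategory.Q.obj X₂)⟦n⟧) (hx : pushHom A n g x = 0) :
    ∃ z, pushHom A n f z = x := by
  have hex := (preadditiveCoyoneda.obj (Opposite.op A)).homologySequence_exact₂ _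
    (DerivedCategory.triangleOfSES_distinguished hS) n
  rw [ShortComplex.ab_exact_iff] at hex
  exact hex x hx

/-- The witness is the connecting homomorphism applied to `c`. Only two facts about it are kept: `f`
kills it, and it can vanish only if `c` comes from the middle term. -/
theorem exists_connecting {f : X₁ ⟶ X₂} {g : X₂ ⟶ X₃} {w : f ≫ g = 0}
    (hS : (ShortComplex.mk f g w).ShortExact) {n' : ℤ} (hn : n + 1 = n') (c : A ⟶ (DerivedCategory.Q.obj X₃)⟦n⟧) :
    ∃ z : A ⟶ (DerivedCategory.Q.obj X₁)⟦n'⟧, pushHom A n' f z = 0 ∧ (z = 0 → ∃ x, pushHom A n g x = c) := by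
  have hT := DerivedCategory.triangleOfSES_distinguished hS
  let F := preadditiveCoyoneda.obj (Opposite.op A)
  have hex := F.homologySequence_exact₃ _ hT n n' hn
  rw [ShortComplex.ab_exact_iff] at hex
  exact ⟨F.homologySequenceδ (DerivedCategory.triangleOfSES hS) n n' hn c,
    ConcreteCategory.congr_hom (F.homologySequenceδ_comp _ hT n n' hn) c, fun h => hex c h⟩

/-- Exactness at the middle of the Mayer–Vietoris sequence: the pair `(x, y)`, seen as a class in
the biproduct, is killed by the difference map. This is the source of existence in part (1). -/
theorem exists_pushHom_of_square (w : t ≫ r = l ≫ b)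
    (h : ∀ i, (IsIso (t.f i) ∧ IsIso (b.f i)) ∨ (IsIso (l.f i) ∧ IsIso (r.f i)))
    (x : A ⟶ (DerivedCategory.Q.obj X₂)⟦n⟧) (y : A ⟶ (DerivedCategory.Q.obj X₃)⟦n⟧)
    (hxy : pushHom A n r x = pushHom A n b y) :
    ∃ z, pushHom A n t z = x ∧ pushHom A n l z = y := by
  have hfst : pushHom A n biprod.fst
      (pushHom A n biprod.inl x + pushHom A n (biprod.inr : X₃ ⟶ X₂ ⊞ X₃) y) = x := by
    rw [map_add, ← pushHom_comp, ← pushHom_comp, biprod.inl_fst, biprod.inr_fst, pushHom_id,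
      pushHom_zero, add_zero]
  have hsnd : pushHom A n biprod.snd
      (pushHom A n biprod.inl x + pushHom A n (biprod.inr : X₃ ⟶ X₂ ⊞ X₃) y) = y := by
    rw [map_add, ← pushHom_comp, ← pushHom_comp, biprod.inl_snd, biprod.inr_snd, pushHom_id,
      pushHom_zero, zero_add]
  obtain ⟨z, hz⟩ := exists_pushHom_eq (shortExact_of_square w h)
    (pushHom A n biprod.inl x + pushHom A n biprod.inr y)
    (by rw [pushHom_desc, hfst, hsnd, hxy, sub_self])
  refine ⟨z, ?_, ?_⟩
  · rw [← hfst, ← hz, ← pushHom_comp, biprod.lift_fst]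
  · rw [← hsnd, ← hz, ← pushHom_comp, biprod.lift_snd]

/-- The connecting map of the Mayer–Vietoris sequence lands in the common kernel of `t` and `l`, so
it measures the failure of uniqueness in part (2). -/
theorem exists_connecting_of_square (w : t ≫ r = l ≫ b)
    (h : ∀ i, (IsIso (t.f i) ∧ IsIso (b.f i)) ∨ (IsIso (l.f i) ∧ IsIso (r.f i)))
    {n' : ℤ} (hn : n + 1 = n') (c : A ⟶ (DerivedCategory.Q.obj X₄)⟦n⟧) :
    ∃ z : A ⟶ (DerivedCategory.Q.obj X₁)⟦n'⟧, pushHom A n' t z = 0 ∧ pushHom A n' l z = 0 ∧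
      (z = 0 → ∃ x y, pushHom A n r x - pushHom A n b y = c) := by
  obtain ⟨z, hz, hz'⟩ := exists_connecting (shortExact_of_square w h) hn c
  refine ⟨z, ?_, ?_, fun h0 => ?_⟩
  · rw [← biprod.lift_fst t l, pushHom_comp, hz, map_zero]
  · rw [← biprod.lift_snd t l, pushHom_comp, hz, map_zero]
  · obtain ⟨v, hv⟩ := hz' h0
    exact ⟨_, _, (pushHom_desc A n r b v).symm.trans hv⟩

end MayerVietoris

/-! ### Projection of a complex in nonnegative degrees onto degree zero -/

section DegreeZero

theorem comp_inv_comp_hom_comp {C : Type*} [Category* C] {U V W W' Z : C} (a : U ⟶ V) (f : V ⟶ W)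
    (e : W' ≅ W) (g : W ⟶ Z) : (a ≫ f ≫ e.inv) ≫ e.hom ≫ g = a ≫ f ≫ g := by
  simp

variable {C : Type*} [Category* C] [Abelian C]

theorem embeddingUpNat_f_zero : ComplexShape.embeddingUpNat.f 0 = 0 := rfl

theorem embeddingUpNat_f_one : ComplexShape.embeddingUpNat.f 1 = 1 := rfl

/-- The projection of a complex in nonnegative degrees, extended by zero, onto an object receiving
a morphism from its term of degree `0`. -/
noncomputable def extendToSingle (N : CochainComplex C ℕ) {F : C} (f : N.X 0 ⟶ F) :
    N.extend ComplexShape.embeddingUpNat ⟶ (CochainComplex.singleFunctor C 0).obj F :=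
  HomologicalComplex.extendMap ((CochainComplex.toSingle₀Equiv _ _).symm f) _ ≫
    (HomologicalComplex.extendSingleIso ComplexShape.embeddingUpNat _ 0 0 embeddingUpNat_f_zero).hom

theorem extendToSingle_f_zero (N : CochainComplex C ℕ) {F : C} (f : N.X 0 ⟶ F) :
    (extendToSingle N f).f 0 =
      (N.extendXIso ComplexShape.embeddingUpNat embeddingUpNat_f_zero).hom ≫ f ≫
        (HomologicalComplex.singleObjXSelf (ComplexShape.up ℤ) 0 F).inv := by
  change (HomologicalComplex.extendMap ((CochainComplex.toSingle₀Equiv _ _).symm f) _).f 0 ≫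
    (HomologicalComplex.extendSingleIso _ _ 0 0 embeddingUpNat_f_zero).hom.f 0 = _
  rw [HomologicalComplex.extendMap_f _ ComplexShape.embeddingUpNat embeddingUpNat_f_zero,
    HomologicalComplex.extendSingleIso_hom_f, CochainComplex.toSingle₀Equiv_symm_apply_f_zero]
  refine (comp_inv_comp_hom_comp _ _ _ _).trans ?_
  congr 2
  exact Category.id_comp _

theorem extendToSingle_comp (N : CochainComplex C ℕ) {F G : C} (f : N.X 0 ⟶ F) (g : F ⟶ G) :
    extendToSingle N f ≫ (CochainComplex.singleFunctor C 0).map g = extendToSingle N (f ≫ g) := by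
  apply HomologicalComplex.to_single_hom_ext
  rw [HomologicalComplex.comp_f, extendToSingle_f_zero, extendToSingle_f_zero]
  change _ ≫ ((HomologicalComplex.single C (ComplexShape.up ℤ) 0).map g).f 0 = _
  rw [HomologicalComplex.single_map_f_self]
  simp

theorem extendMap_extendToSingle {N N' : CochainComplex C ℕ} (φ : N ⟶ N') {F : C}
    (f : N'.X 0 ⟶ F) :
    HomologicalComplex.extendMap φ ComplexShape.embeddingUpNat ≫ extendToSingle N' f =
      extendToSingle N (φ.f 0 ≫ f) := by
  apply HomologicalComplex.to_single_hom_ext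
  rw [HomologicalComplex.comp_f, extendToSingle_f_zero, extendToSingle_f_zero,
    HomologicalComplex.extendMap_f _ ComplexShape.embeddingUpNat embeddingUpNat_f_zero]
  refine (comp_inv_comp_hom_comp _ _ _ _).trans ?_
  rw [Category.assoc]
  rfl

/-- The composition with a morphism factoring through the differential is homotopic to zero. -/
theorem homotopy_extendToSingle_d (N : CochainComplex C ℕ) {F : C} (h : N.X 1 ⟶ F) :
    Nonempty (Homotopy (extendToSingle N (N.d 0 1 ≫ h)) 0) := by
  let e := ComplexShape.embeddingUpNat
  -- The homotopy has a single nonzero component, `h` from degree `1` to degree `0`. In degree `0`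
  -- its boundary is therefore `d` followed by `h`, since the component into degree `-1` vanishes.
  let η : ∀ i j : ℤ, (ComplexShape.up ℤ).Rel j i → ((N.extend e).X i ⟶
      ((CochainComplex.singleFunctor C 0).obj F).X j) := fun i j hij =>
    if hj : j = 0 then
      (HomologicalComplex.XIsoOfEq _ (by subst hj; simpa using hij.symm : i = 1)).hom ≫
        (N.extendXIso e embeddingUpNat_f_one).hom ≫ h ≫
          (HomologicalComplex.singleObjXIsoOfEq (ComplexShape.up ℤ) 0 F j hj).inv
    else 0
  have key : extendToSingle N (N.d 0 1 ≫ h) = Homotopy.nullHomotopicMap' η := by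
    apply HomologicalComplex.to_single_hom_ext
    rw [Homotopy.nullHomotopicMap'_f (k₂ := -1) (k₁ := 0) (k₀ := 1) (by simp) (by simp),
      extendToSingle_f_zero,
      N.extend_d_eq e embeddingUpNat_f_zero embeddingUpNat_f_one]
    simp [η]
    rfl
  exact ⟨(Homotopy.ofEq key).trans (Homotopy.nullHomotopy' η)⟩

/-- Verifies the hypothesis of the Mayer–Vietoris square. Away from degree `0` the single complexes
vanish, while `φ` is invertible in positive degrees by hypothesis and between zero objects in
negative ones. In degree `0` the projections are `f` and `f'` up to canonical isomorphisms. -/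
theorem isIso_extendMap_or_isIso_extendToSingle {N N' : CochainComplex C ℕ} (φ : N ⟶ N')
    (hφ : ∀ k, IsIso (φ.f (k + 1))) {F F' : C} (f : N.X 0 ⟶ F) (f' : N'.X 0 ⟶ F')
    (hf : IsIso f) (hf' : IsIso f') (g : F ⟶ F') (i : ℤ) :
    (IsIso ((HomologicalComplex.extendMap φ ComplexShape.embeddingUpNat).f i) ∧
      IsIso (((CochainComplex.singleFunctor C 0).map g).f i)) ∨
    (IsIso ((extendToSingle N f).f i) ∧ IsIso ((extendToSingle N' f').f i)) := by
  by_cases hi : i = 0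
  · subst hi
    refine Or.inr ⟨?_, ?_⟩
    · rw [extendToSingle_f_zero]
      exact inferInstanceAs (IsIso (_ ≫ f ≫ (HomologicalComplex.singleObjXSelf _ _ _).inv))
    · rw [extendToSingle_f_zero]
      exact inferInstanceAs (IsIso (_ ≫ f' ≫ (HomologicalComplex.singleObjXSelf _ _ _).inv))
  · refine Or.inl ⟨?_, ?_⟩
    · by_cases hk : ∃ k, ComplexShape.embeddingUpNat.f k = i
      · obtain ⟨_ | k, hk⟩ := hk
        · exact absurd hk.symm hi
        · have := hφ k
          rw [HomologicalComplex.extendMap_f _ _ hk]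
          infer_instance
      · exact ((HomologicalComplex.isZero_extend_X _ _ _ (not_exists.1 hk)).isIso
          (HomologicalComplex.isZero_extend_X _ _ _ (not_exists.1 hk)) _)
    · exact (HomologicalComplex.isZero_single_obj_X _ _ _ _ hi).isIso
        (HomologicalComplex.isZero_single_obj_X _ _ _ _ hi) _

end DegreeZero

end BottChern
namespace BottChern

open CategoryTheory Limits TopologicalSpace Opposite

/-! ### Comparison of hypercohomology with sheaf cohomology -/

section Hypercohomology

variable {X : Type u} [TopologicalSpace X]

theorem Hyper.map_eq_pushHom
    {K L : CochainComplex (Sheaf (Opens.grothendieckTopology (TopCat.of X)) AddCommGrpCat.{u}) ℤ}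
    (f : K ⟶ L) (n : ℤ) : Hyper.map f n = pushHom _ n f := rfl

/-- Naturality of the comparison: postcomposing an `Ext` class with the degree `0` class of `g`
becomes, in the derived category, composition with the shift of `g`. -/
theorem Hyper.single_map
    {F G : Sheaf (Opens.grothendieckTopology (TopCat.of X)) AddCommGrpCat.{u}} (g : F ⟶ G) (n : ℕ)
    (x : Hyper ((CochainComplex.singleFunctor _ 0).obj F) n) :
    Hyper.single G n (Hyper.map ((CochainComplex.singleFunctor _ 0).map g) n x) =
      Sheaf.H.map g n (Hyper.single F n x) := by
  apply (Hyper.single G n).symm.injective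
  rw [AddEquiv.symm_apply_apply]
  obtain ⟨y, rfl⟩ := (Hyper.single F n).symm.surjective x
  rw [AddEquiv.apply_symm_apply]
  change _ = (y.comp (Abelian.Ext.mk₀ g) (add_zero n)).hom
  rw [Abelian.Ext.comp_hom, Abelian.Ext.mk₀_hom, ShiftedHom.comp_mk₀]
  rfl

/-- The value at a point of the section defined by a cohomology class of degree `0`. -/
noncomputable def H0.section {M : Type} [AddCommGroup M] (F : LocalSections X M)
    (x : Sheaf.H.{u} F.sheaf 0) : F.sec ⊤ :=
  Sheaf.H.equiv₀ F.sheaf (Preorder.isTerminalTop (Opens (TopCat.of X))) x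

end Hypercohomology

/-! ### The Bott–Chern square, and classes in low degree -/

section Complexes

variable (E : Type) [NormedAddCommGroup E] [NormedSpace ℂ E]
variable (X : Type u) [TopologicalSpace X] [ChartedSpace E X] [IsManifold 𝓘(ℂ, E) ω X]

/-- `bcToConst` unfolds to `extendToSingle` of an identity, so both composites are `extendToSingle`
of the inclusion of constant sheaves. -/
theorem bcIncl_bcToConst {A B : AddSubgroup ℂ} (h : A ≤ B) (p q : ℕ) :
    bcIncl E X h p q ≫ bcToConst E X B p q =
      bcToConst E X A p q ≫
        (CochainComplex.singleFunctor _ 0).map (LocalSections.constIncl X h) := by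
  refine (extendMap_extendToSingle _ (𝟙 _)).trans (Eq.trans ?_
    (extendToSingle_comp (bcComplexNat E X A p q) (𝟙 _) (LocalSections.constIncl X h)).symm)
  exact congrArg (extendToSingle (bcComplexNat E X A p q))
    ((Category.comp_id (bcObjIncl E X h p q 0)).trans (Category.id_comp _).symm)

theorem bcIncl_square_isIso {A B : AddSubgroup ℂ} (h : A ≤ B) (p q : ℕ) (i : ℤ) :
    (IsIso ((bcIncl E X h p q).f i) ∧
      IsIso (((CochainComplex.singleFunctor _ 0).map (LocalSections.constIncl X h)).f i)) ∨
    (IsIso ((bcToConst E X A p q).f i) ∧ IsIso ((bcToConst E X B p q).f i)) :=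
  isIso_extendMap_or_isIso_extendToSingle _
    (fun k => inferInstanceAs (IsIso (𝟙 (bcObj E X A p q (k + 1))))) (𝟙 _) (𝟙 _)
    (IsIso.id _) (IsIso.id _) _ i

/-- The projection to degree `0` followed by the first differential is null-homotopic, through the
identity of the term of degree `1`. Hence `bcD` kills every class coming from the hypercohomology of
the complex. -/
theorem hyper_map_bcToConst_bcD (A : AddSubgroup ℂ) (p q : ℕ) (n : ℤ)
    (x : Hyper (bcComplex E X A p q) n) :
    Hyper.map ((CochainComplex.singleFunctor _ 0).map (bcD E X A p q 0)) n
      (Hyper.map (bcToConst E X A p q) n x) = 0 := by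
  obtain ⟨η⟩ := homotopy_extendToSingle_d (bcComplexNat E X A p q) (𝟙 _)
  have hd : (bcComplexNat E X A p q).d 0 1 = bcD E X A p q 0 :=
    CochainComplex.of_d (bcObj E X A p q) (bcD E X A p q) 0
  have h : bcToConst E X A p q ≫ (CochainComplex.singleFunctor _ 0).map (bcD E X A p q 0) =
      extendToSingle (bcComplexNat E X A p q) ((bcComplexNat E X A p q).d 0 1 ≫ 𝟙 _) := by
    refine (extendToSingle_comp (bcComplexNat E X A p q) (𝟙 _) (bcD E X A p q 0)).trans ?_
    rw [hd]
    exact congrArg (extendToSingle (bcComplexNat E X A p q))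
      ((Category.id_comp (bcD E X A p q 0)).trans (Category.comp_id _).symm)
  refine (pushHom_comp _ n (bcToConst E X A p q) ((CochainComplex.singleFunctor _ 0).map
    (bcD E X A p q 0)) x).symm.trans ?_
  rw [h]
  exact pushHom_eq_zero_of_homotopy _ n η x

theorem exists_epsBC_eq_and_phiInt_eq (p q : ℕ) (ξ : BCGroupC E X p q)
    (α : ConstH X (tateZ p) (p + q)) (h : phi E X p q ξ = eps X p (p + q) α) :
    ∃ ξ' : BCGroupZ E X p q, epsBC E X p q ξ' = ξ ∧ phiInt E X p q ξ' = α := by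
  obtain ⟨a, rfl⟩ := (Hyper.single _ _).surjective α
  have h' : Hyper.single _ (p + q) (Hyper.map (bcToConst E X ⊤ p q) _ ξ) = Hyper.single _ (p + q)
      (Hyper.map ((CochainComplex.singleFunctor _ 0).map
        (LocalSections.constIncl X (le_top : tateZ p ≤ ⊤))) _ a) :=
    h.trans (Hyper.single_map _ _ _).symm
  obtain ⟨z, hz₁, hz₂⟩ := exists_pushHom_of_square (bcIncl_bcToConst E X le_top p q)
    (bcIncl_square_isIso E X le_top p q) ξ a ((Hyper.single _ _).injective h')
  exact ⟨z, hz₁, congrArg (Hyper.single _ _) hz₂⟩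

/-- As `p > 0`, the term `𝒪` is present, and the first component of the differential is the function
itself viewed as a `0`-form. -/
theorem section_eq_zero_of_constToForms_eq_zero (A : AddSubgroup ℂ) {p q : ℕ} (hp : 0 < p)
    {U : Opens X} (s : (LocalSections.const X A).sec U)
    (hs : (bcD E X A p q 0).hom.app (op U) s = 0) (x : U) : s.1 x = 0 := by
  have h1 : (if 0 < p then fun x : U => ContinuousAlternatingMap.constOfIsEmpty ℝ E (Fin 0) (s.1 x)
      else 0) x = 0 := congrArg Prod.fst (congrFun (congrArg Subtype.val hs) x)
  rw [if_pos hp] at h1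
  simpa using congrArg (fun η : AltForm E 0 => η 0) h1

/-- The global section in question is killed by the first differential, which is injective on
sections when `p > 0`. -/
theorem section_bcToConst_eq_zero (A : AddSubgroup ℂ) {p q : ℕ} (hp : 0 < p)
    (x : Hyper (bcComplex E X A p q) ((0 : ℕ) : ℤ)) (y : (⊤ : Opens X)) :
    (H0.section _ (Hyper.single _ 0 (Hyper.map (bcToConst E X A p q) _ x))).1 y = 0 := by
  refine section_eq_zero_of_constToForms_eq_zero E X A (p := p) (q := q) hp _ ?_ y
  refine (Sheaf.H.equiv₀_naturality (Preorder.isTerminalTop (Opens (TopCat.of X)))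
    (bcD E X A p q 0) _).trans ?_
  have h := Hyper.single_map (bcD E X A p q 0) 0 (Hyper.map (bcToConst E X A p q) _ x)
  rw [hyper_map_bcToConst_bcD, map_zero] at h
  exact (congrArg _ h.symm).trans (map_zero _)

theorem section_constIncl {A B : AddSubgroup ℂ} (h : A ≤ B)
    (y : Sheaf.H.{u} (LocalSections.const X A).sheaf 0) (x : (⊤ : Opens X)) :
    (H0.section _ (Sheaf.H.map (LocalSections.constIncl X h) 0 y)).1 x ∈ A := by
  have e := Sheaf.H.equiv₀_naturality (Preorder.isTerminalTop (Opens (TopCat.of X)))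
    (LocalSections.constIncl X h) y
  have e' : (H0.section _ (Sheaf.H.map (LocalSections.constIncl X h) 0 y)).1 x =
    (H0.section _ y).1 x := (congrFun (congrArg Subtype.val e) x).symm
  rw [e']
  exact (H0.section _ y).2.2 x

theorem one_notMem_tateZ_one : (1 : ℂ) ∉ tateZ 1 := by
  rintro ⟨m, hm⟩
  simpa using congrArg Complex.re hm

/-- The class is the image of the constant function `1` under the connecting map from `H⁰(X, ℂ)`.
With `p = 1`, `q = 0` the target degree is `p + q = 1`, the term `𝒪` is present, and `ℤ(1)` does not
contain `1`. -/
theorem exists_ne_zero_epsBC_eq_zero_and_phiInt_eq_zero [Nonempty X] :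
    ∃ z : BCGroupZ E X 1 0, z ≠ 0 ∧ epsBC E X 1 0 z = 0 ∧ phiInt E X 1 0 z = 0 := by
  let s : (LocalSections.const X (⊤ : AddSubgroup ℂ)).sec ⊤ :=
    ⟨fun _ => 1, IsLocallyConstant.const 1, fun _ => trivial⟩
  let e := Sheaf.H.equiv₀ (LocalSections.const X (⊤ : AddSubgroup ℂ)).sheaf
    (Preorder.isTerminalTop (Opens (TopCat.of X)))
  obtain ⟨z, hz₁, hz₂, hz⟩ := exists_connecting_of_square
    (bcIncl_bcToConst E X (le_top : tateZ 1 ≤ ⊤) 1 0) (bcIncl_square_isIso E X le_top 1 0)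
    (n := ((0 : ℕ) : ℤ)) (n' := ((1 + 0 : ℕ) : ℤ)) (by simp)
    ((Hyper.single _ 0).symm (e.symm s))
  refine ⟨z, fun h0 => ?_, hz₁, (congrArg (Hyper.single _ _) hz₂).trans (map_zero _)⟩
  -- If the class vanished, `1` would be the difference of a section coming from `B_ℂ` and one
  -- coming from `ℤ(1)`. At a point the former is `0` and the latter lies in `2πiℤ`, which is
  -- absurd.
  obtain ⟨x, y, hxy⟩ := hz h0
  obtain ⟨pt⟩ := ‹Nonempty X›
  have h1 : e (Hyper.single _ 0 (Hyper.map (bcToConst E X ⊤ 1 0) _ x)) -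
      e (Hyper.single _ 0 (Hyper.map ((CochainComplex.singleFunctor _ 0).map
        (LocalSections.constIncl X (le_top : tateZ 1 ≤ ⊤))) _ y)) = s := by
    rw [← map_sub, ← map_sub, Hyper.map_eq_pushHom, Hyper.map_eq_pushHom]
    refine (congrArg (fun w => e (Hyper.single _ 0 w)) hxy).trans ?_
    rw [AddEquiv.apply_symm_apply]
    exact e.apply_symm_apply s
  rw [Hyper.single_map] at h1
  have h2 := section_bcToConst_eq_zero E X ⊤ one_pos x ⟨pt, trivial⟩
  have h3 := section_constIncl X (le_top : tateZ 1 ≤ ⊤) (Hyper.single _ 0 y) ⟨pt, trivial⟩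
  have h4 : (H0.section _ (Hyper.single _ 0 (Hyper.map (bcToConst E X ⊤ 1 0) _ x))).1 ⟨pt, trivial⟩ -
      (H0.section _ (Sheaf.H.map (LocalSections.constIncl X (le_top : tateZ 1 ≤ ⊤)) 0
        (Hyper.single _ 0 y))).1 ⟨pt, trivial⟩ = 1 :=
    congrFun (congrArg Subtype.val h1) (⟨pt, trivial⟩ : (⊤ : Opens X))
  rw [h2, zero_sub, neg_eq_iff_eq_neg] at h4
  rw [h4] at h3
  exact one_notMem_tateZ_one (by simpa using (tateZ 1).neg_mem h3)

end Complexes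

end BottChern

/-! ### The theorem -/

theorem mainTheorem10 :
    (∀ (n : ℕ) (X : Type u) [TopologicalSpace X] [ChartedSpace (EuclideanSpace ℂ (Fin n)) X]
        [IsManifold 𝓘(ℂ, EuclideanSpace ℂ (Fin n)) ω X] (p q : ℕ)
        (ξ : BottChern.BCGroupC (EuclideanSpace ℂ (Fin n)) X p q)
        (α : BottChern.ConstH X (BottChern.tateZ p) (p + q)),
        BottChern.phi (EuclideanSpace ℂ (Fin n)) X p q ξ = BottChern.eps X p (p + q) α →
          ∃ ξ' : BottChern.BCGroupZ (EuclideanSpace ℂ (Fin n)) X p q,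
            BottChern.epsBC (EuclideanSpace ℂ (Fin n)) X p q ξ' = ξ ∧
              BottChern.phiInt (EuclideanSpace ℂ (Fin n)) X p q ξ' = α) ∧
    (∀ n : ℕ, ∃ (X : Type) (_ : TopologicalSpace X)
        (_ : ChartedSpace (EuclideanSpace ℂ (Fin n)) X)
        (_ : IsManifold 𝓘(ℂ, EuclideanSpace ℂ (Fin n)) ω X),
        T2Space X ∧ SecondCountableTopology X ∧ ConnectedSpace X ∧
        ∃ (p q : ℕ) (ξ : BottChern.BCGroupC (EuclideanSpace ℂ (Fin n)) X p q)
          (α : BottChern.ConstH X (BottChern.tateZ p) (p + q)),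
          BottChern.phi (EuclideanSpace ℂ (Fin n)) X p q ξ = BottChern.eps X p (p + q) α ∧
          ∃ ξ₁ ξ₂ : BottChern.BCGroupZ (EuclideanSpace ℂ (Fin n)) X p q, ξ₁ ≠ ξ₂ ∧
            (BottChern.epsBC (EuclideanSpace ℂ (Fin n)) X p q ξ₁ = ξ ∧
              BottChern.phiInt (EuclideanSpace ℂ (Fin n)) X p q ξ₁ = α) ∧
            (BottChern.epsBC (EuclideanSpace ℂ (Fin n)) X p q ξ₂ = ξ ∧
              BottChern.phiInt (EuclideanSpace ℂ (Fin n)) X p q ξ₂ = α)) := by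
  -- For non-uniqueness take `X = ℂⁿ`, `(p, q) = (1, 0)` and `ξ = α = 0`: both `0` and the nonzero
  -- class in the common kernel are lifts.
  refine ⟨fun n X _ _ _ p q ξ α h => BottChern.exists_epsBC_eq_and_phiInt_eq _ X p q ξ α h,
    fun n => ⟨EuclideanSpace ℂ (Fin n), inferInstance, inferInstance, inferInstance, inferInstance,
      inferInstance, inferInstance, 1, 0, 0, 0, by rw [map_zero, map_zero], ?_⟩⟩
  obtain ⟨z, hz, h₁, h₂⟩ := BottChern.exists_ne_zero_epsBC_eq_zero_and_phiInt_eq_zero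
    (EuclideanSpace ℂ (Fin n)) (EuclideanSpace ℂ (Fin n))
  exact ⟨z, 0, hz, ⟨h₁, h₂⟩, map_zero _, map_zero _⟩
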